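/- **Setting.** Fix a many-sorted constraint domain $\mathcal A$ (a signature of sorted function and relation symbols, with equality, interpreted in nonempty carriers; e.g. linear integer arithmetic with integer arrays). A constraint is a finite conjunction of atomic constraints (equations between terms of the same sort, or relation symbols applied to terms). An atom is $p(t_1,\dots,t_k)$ with $p$ a predicate symbol and $t_j$ terms. A CLP program is a finite set of clauses $H \leftarrow c, G$ with $H$ an atom, $c$ a constraint and $G$ a finite conjunction of atoms; $\mathcal M(\mathit{Prog})$ is its least model over $\mathcal A$. For a clause $C$ of the form $H\leftarrow c,L,B,R$, the set of linking variables of the atom $B$ is $\mathit{linkvars}(B,C)=\mathit{vars}(B)\cap \mathit{vars}(\{H,c,L,R\})$. Let $\mathtt{unsafe}$ be a nullary predicate symbol. **Rules.** A definition is a clause $\mathtt{newp}(V)\leftarrow B$ with $V$ a tuple of distinct variables and $B$ an atom. *Unfolding* $\mathtt{newp}(V)\leftarrow B$ using $\mathit{Prog}$ produces, for each (renamed apart) clause $H\leftarrow c,G$ of $\mathit{Prog}$ whose head has the predicate symbol of $B$, the clause $(\mathtt{newp}(V)\leftarrow E, c, G)\sigma$, where $\sigma$ is a most general unifier of those equations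 between corresponding arguments of $B$ and $H$ both of whose sides are variables, and $E$ consists of the remaining equations between corresponding arguments; clauses for which $B=H\wedge c$ is unsatisfiable in $\mathcal A$ may be omitted. A clause $H\leftarrow c,L,B,R$ *can be folded* with respect to $B$ using a definition $\mathtt{newq}(Q)\leftarrow S$ if there is a substitution $\theta$ with $S\theta=B$ mapping each variable of $S$ not in $Q$ to a variable that occurs neither in $H,c,L,R$ nor in the image under $\theta$ of another variable of $S$; folding replaces $B$ by $\mathtt{newq}(Q\theta)$. **The NLR strategy** on input $\mathit{Prog}$ maintains a set $\mathit{Defs}$ of definitions, initially $\{\mathtt{unsafe}\leftarrow\mathtt{unsafe}\}$, and the set $\mathcal S$ of the clauses obtained so far by unfolding them, initially empty. It performs the following steps, in any order and with any choices. 1. Unfold a definition in $\mathit{Defs}$ that has not been unfolded yet, and add the resulting clauses to $\mathcal S$. 2. If some $C\in \mathcal S$ of the form $H\leftarrow c,L,B,R$ cannot be folded with respect to $B$ using any definition in $\mathit{Defs}$, let $V=\mathit{linkvars}(B,C)$ and let $\mathtt{newp}$ be a predicate symbol not occurring in $\mathit{Prog}\cup\mathit{Defs}$. If $\mathit{Defs}$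 contains a definition $D$ of the form $\mathtt{newq}(Q)\leftarrow B\vartheta$ for a renaming substitution $\vartheta$, then replace $D$ in $\mathit{Defs}$ by the (not yet unfolded) definition $\mathtt{newp}(V\vartheta\cup Q)\leftarrow B\vartheta$ and delete from $\mathcal S$ the clauses obtained by unfolding $D$. Otherwise add the definition $\mathtt{newp}(V)\leftarrow B$ to $\mathit{Defs}$. The strategy stops when all definitions in $\mathit{Defs}$ have been unfolded and every clause in $\mathcal S$ can be folded with respect to each of its body atoms using $\mathit{Defs}$. Its output $\mathit{Prog}'$ consists of the clauses of $\mathcal S$, each folded with respect to all its body atoms using definitions in $\mathit{Defs}$. **Theorem (Termination and Correctness of the NLR Strategy).** For every CLP program $\mathit{Prog}$, the NLR strategy terminates (no run is infinite, and every run that cannot be continued has stopped with an output), and every output $\mathit{Prog}'$ of every run is a CLP program (in particular finite) such that $$\mathtt{unsafe}\in\mathcal M(\mathit{Prog})\quad\Longleftrightarrow\quad\mathtt{unsafe}\in\mathcal M(\mathit{Prog}').$$ -/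

import Mathlib

/-! Constraint logic programs over a many-sorted constraint domain, their least models, and the
non-linking variable removal strategy as a (nondeterministic) transition system. -/

universe u

namespace CLP

/-- A many-sorted first-order signature of constraints. Equality is always available in addition
to the relation symbols. -/
structure Signature where
  Srt : Type u
  Fn : Type u
  dom : Fn → List Srt
  cod : Fn → Srt
  Rel : Type u
  relDom : Rel → List Srt

/-- A constraint domain: a structure interpreting the signature (for example, integers and integer
arrays). -/
structure ConstraintDomain (Sg : Signature.{u}) where
  carrier : Sg.Srt → Type u
  nonempty : ∀ s, Nonempty (carrier s)
  fn : (f : Sg.Fn) → ((i : Fin (Sg.dom f).length) → carrier ((Sg.dom f).get i)) →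
    carrier (Sg.cod f)
  rel : (r : Sg.Rel) → ((i : Fin (Sg.relDom r).length) → carrier ((Sg.relDom r).get i)) → Prop

/-- A variable is a sort together with an index. -/
abbrev Var (Sg : Signature.{u}) := Sg.Srt × ℕ

inductive Term (Sg : Signature.{u}) : Sg.Srt → Type u
  | var {s : Sg.Srt} (n : ℕ) : Term Sg s
  | app (f : Sg.Fn) (args : (i : Fin (Sg.dom f).length) → Term Sg ((Sg.dom f).get i)) :
      Term Sg (Sg.cod f)

/-- A term bundled with its sort. -/
abbrev STerm (Sg : Signature.{u}) := (s : Sg.Srt) × Term Sg s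

/-- Atomic constraints: equations between terms of the same sort, and relation symbols applied to
terms. -/
inductive AtomicConstraint (Sg : Signature.{u}) : Type u
  | eq {s : Sg.Srt} (t t' : Term Sg s) : AtomicConstraint Sg
  | rel (r : Sg.Rel) (args : (i : Fin (Sg.relDom r).length) → Term Sg ((Sg.relDom r).get i)) :
      AtomicConstraint Sg

/-- An atom `p(t₁,…,tₖ)`. The predicate symbol is the name together with the list of sorts of the
arguments. -/
structure Atom (Sg : Signature.{u}) where
  name : ℕ
  args : List (STerm Sg)

/-- A clause `H :- c, G`: the constraint `c` is a finite conjunction of atomic constraints, and `G`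
a finite conjunction of atoms. -/
structure Clause (Sg : Signature.{u}) where
  head : Atom Sg
  constr : List (AtomicConstraint Sg)
  body : List (Atom Sg)

/-- A ground atom over the carriers of the constraint domain. -/
structure GroundAtom {Sg : Signature.{u}} (A : ConstraintDomain Sg) where
  name : ℕ
  args : List ((s : Sg.Srt) × A.carrier s)

section SyntaxPart

variable {Sg : Signature.{u}}

/-- Sort-preserving substitutions of terms for variables. -/
abbrev Subst (Sg : Signature.{u}) := (s : Sg.Srt) → ℕ → Term Sg s

/-- Sort-preserving maps from variables to variables (not necessarily injective). -/
abbrev VarMap (Sg : Signature.{u}) := Sg.Srt → ℕ → ℕ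

def VarMap.toFun (r : VarMap Sg) (v : Var Sg) : Var Sg := (v.1, r v.1 v.2)

def VarMap.toSubst (r : VarMap Sg) : Subst Sg := fun s n => Term.var (r s n)

def Term.vars : {s : Sg.Srt} → Term Sg s → Set (Var Sg)
  | s, .var n => {(s, n)}
  | _, .app _ args => ⋃ i, (args i).vars

def Term.subst (θ : Subst Sg) : {s : Sg.Srt} → Term Sg s → Term Sg s
  | s, .var n => θ s n
  | _, .app f args => .app f fun i => (args i).subst θ

def AtomicConstraint.vars : AtomicConstraint Sg → Set (Var Sg)
  | .eq t t' => t.vars ∪ t'.vars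
  | .rel _ args => ⋃ i, (args i).vars

def AtomicConstraint.subst (θ : Subst Sg) : AtomicConstraint Sg → AtomicConstraint Sg
  | .eq t t' => .eq (t.subst θ) (t'.subst θ)
  | .rel r args => .rel r fun i => (args i).subst θ

def Atom.vars (B : Atom Sg) : Set (Var Sg) := {v | ∃ t ∈ B.args, v ∈ t.2.vars}

def Atom.subst (θ : Subst Sg) (B : Atom Sg) : Atom Sg :=
  ⟨B.name, B.args.map fun t => ⟨t.1, t.2.subst θ⟩⟩

/-- Two atoms have the same predicate symbol. -/
def Atom.SamePred (B B' : Atom Sg) : Prop :=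
  B.name = B'.name ∧ B.args.map Sigma.fst = B'.args.map Sigma.fst

/-- The variables of `H, c, L, R` in a clause `H :- c, L, B, R`, where `B` is the `i`-th body
atom. -/
def Clause.restVars (C : Clause Sg) (i : Fin C.body.length) : Set (Var Sg) :=
  C.head.vars ∪ {v | ∃ a ∈ C.constr, v ∈ a.vars} ∪ {v | ∃ B ∈ C.body.eraseIdx i, v ∈ B.vars}

/-- The linking variables in a clause of its `i`-th body atom. -/
def Clause.linkvars (C : Clause Sg) (i : Fin C.body.length) : Set (Var Sg) :=
  (C.body.get i).vars ∩ C.restVars i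

end SyntaxPart

section Semantics

variable {Sg : Signature.{u}} {A : ConstraintDomain Sg}

abbrev Valuation (A : ConstraintDomain Sg) := (s : Sg.Srt) → ℕ → A.carrier s

def Term.eval (α : Valuation A) : {s : Sg.Srt} → Term Sg s → A.carrier s
  | s, .var n => α s n
  | _, .app f args => A.fn f fun i => (args i).eval α

def AtomicConstraint.Holds (α : Valuation A) : AtomicConstraint Sg → Prop
  | .eq t t' => t.eval α = t'.eval α
  | .rel r args => A.rel r fun i => (args i).eval α

def Atom.eval (α : Valuation A) (B : Atom Sg) : GroundAtom A :=
  ⟨B.name, B.args.map fun t => ⟨t.1, t.2.eval α⟩⟩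

/-- `I` is a model, over the constraint domain `A`, of all clauses of the program `P`. -/
def IsModel (P : Set (Clause Sg)) (I : Set (GroundAtom A)) : Prop :=
  ∀ C ∈ P, ∀ α : Valuation A, (∀ a ∈ C.constr, a.Holds α) → (∀ B ∈ C.body, B.eval α ∈ I) →
    C.head.eval α ∈ I

/-- The least model of a program over the constraint domain `A`. -/
def leastModel (A : ConstraintDomain Sg) (P : Set (Clause Sg)) : Set (GroundAtom A) :=
  ⋂₀ {I | IsModel P I}

theorem isLeast_leastModel (P : Set (Clause Sg)) :
    IsLeast {I : Set (GroundAtom A) | IsModel P I} (leastModel A P) :=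
  ⟨fun C hC α hc hb I hI => hI C hC α hc fun B hB => hb B hB I hI,
    fun _ hI _ hx => hx _ hI⟩

end Semantics

/-- The name of the nullary predicate `unsafe`. -/
def unsafeName : ℕ := 0

/-- `unsafe ∈ M(P)`. -/
def UnsafeIn {Sg : Signature.{u}} (A : ConstraintDomain Sg) (P : Set (Clause Sg)) : Prop :=
  (⟨unsafeName, []⟩ : GroundAtom A) ∈ leastModel A P

/-- A definition clause `newp(V) :- B`, where `V` is a tuple of variables and `B` one atom. -/
structure Definition (Sg : Signature.{u}) where
  name : ℕ
  vars : List (Var Sg)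
  body : Atom Sg

section Rules

variable {Sg : Signature.{u}}

def Definition.head (D : Definition Sg) : Atom Sg :=
  ⟨D.name, D.vars.map fun v => ⟨v.1, .var v.2⟩⟩

/-- The pairs of variables in corresponding argument positions of two argument lists. The variables
of the two lists are kept apart by the two summands. -/
inductive VarEquation (as bs : List (STerm Sg)) : Var Sg ⊕ Var Sg → Var Sg ⊕ Var Sg → Prop
  | mk (s : Sg.Srt) (m n : ℕ) (h : ((⟨s, .var m⟩ : STerm Sg), (⟨s, .var n⟩ : STerm Sg)) ∈ as.zip bs) :
      VarEquation as bs (Sum.inl (s, m)) (Sum.inr (s, n))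

def STerm.IsVar (t : STerm Sg) : Prop := ∃ n, t.2 = .var n

open Classical in
/-- The equations between corresponding arguments, except those between two variables. -/
noncomputable def nonVarEquations (as bs : List (STerm Sg)) : List (AtomicConstraint Sg) :=
  (as.zip bs).filterMap fun p =>
    if h : p.1.1 = p.2.1 then
      if STerm.IsVar p.1 ∧ STerm.IsVar p.2 then none
      else some (.eq (h ▸ p.1.2) p.2.2)
    else none

/-- `R` is obtained by unfolding the definition `D` (that is, `newp(V) :- B`) with respect to `B`
using the clause `C` (that is, `H :- c, G`): `C` is renamed apart from `D`, the equations `B = H`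
between corresponding arguments are added, and those between two variables are solved by a most
general unifier. Both the renaming apart and the unifier are contained in the maps `ρ` (for the
variables of `D`) and `ρ'` (for those of `C`), which identify two variables exactly when the
variable equations force this. -/
def Resolvent (D : Definition Sg) (C R : Clause Sg) : Prop :=
  D.body.SamePred C.head ∧
  ∃ ρ ρ' : VarMap Sg,
    (∀ a b : Var Sg ⊕ Var Sg,
      Sum.elim ρ.toFun ρ'.toFun a = Sum.elim ρ.toFun ρ'.toFun b ↔
        Relation.EqvGen (VarEquation D.body.args C.head.args) a b) ∧
    R.head = D.head.subst ρ.toSubst ∧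
    R.constr =
      nonVarEquations (D.body.subst ρ.toSubst).args (C.head.subst ρ'.toSubst).args ++
        C.constr.map (AtomicConstraint.subst ρ'.toSubst) ∧
    R.body = C.body.map (Atom.subst ρ'.toSubst)

/-- `S` is a set of clauses obtained by unfolding `D` using `P`: one clause for each clause of `P`
whose head has the predicate symbol of the body of `D`, where those that yield an unsatisfiable
constraint may be left out. -/
def Unfolding (A : ConstraintDomain Sg) (P : Set (Clause Sg)) (D : Definition Sg)
    (S : Set (Clause Sg)) : Prop :=
  ∃ T ⊆ {C ∈ P | D.body.SamePred C.head},
    (∀ C ∈ P, (∃ α β : Valuation A, D.body.eval α = C.head.eval β ∧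
      ∀ a ∈ C.constr, a.Holds β) → C ∈ T) ∧
    ∃ r : Clause Sg → Clause Sg, (∀ C ∈ T, Resolvent D C (r C)) ∧ S = r '' T

/-- The clause `C`, of the form `H :- c, L, B, R` with `B` its `i`-th body atom, can be folded with
respect to `B` using the definition `D` with matching substitution `θ`; the variables in the body of
`D` which are not in its head must go to distinct variables that do not occur outside `B` (nor in the
other arguments of the new atom). -/
def FoldsWith (C : Clause Sg) (i : Fin C.body.length) (D : Definition Sg) (θ : Subst Sg) : Prop :=
  D.body.subst θ = C.body.get i ∧
  ∀ v ∈ D.body.vars, v ∉ D.vars →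
    ∃ n, θ v.1 v.2 = .var n ∧ (v.1, n) ∉ C.restVars i ∧
      ∀ w ∈ D.body.vars, w ≠ v → (v.1, n) ∉ (θ w.1 w.2).vars

def Foldable (Defs : Set (Definition Sg)) (C : Clause Sg) (i : Fin C.body.length) : Prop :=
  ∃ D ∈ Defs, ∃ θ, FoldsWith C i D θ

/-- `C'` is obtained from `C` by folding with respect to all body atoms using definitions in `Defs`.
A folding step removes only variables that occur in no other atom, so folding one atom does not
affect the applicability condition of the others. -/
def FoldsTo (Defs : Set (Definition Sg)) (C C' : Clause Sg) : Prop :=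
  C'.head = C.head ∧ C'.constr = C.constr ∧
  ∃ h : C'.body.length = C.body.length,
    ∀ i : Fin C.body.length, ∃ D ∈ Defs, ∃ θ, FoldsWith C i D θ ∧
      C'.body.get (i.cast h.symm) = D.head.subst θ

/-- The predicate name `p` does not occur in `P` or `Defs`. -/
def Fresh (P : Set (Clause Sg)) (Defs : Set (Definition Sg)) (p : ℕ) : Prop :=
  (∀ C ∈ P, p ≠ C.head.name ∧ ∀ B ∈ C.body, p ≠ B.name) ∧
  ∀ D ∈ Defs, p ≠ D.name ∧ p ≠ D.body.name

/-- The list `V` is a tuple of variables without repetitions, with underlying set `X`. -/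
def IsTuple (V : List (Var Sg)) (X : Set (Var Sg)) : Prop :=
  V.Nodup ∧ ∀ v, v ∈ V ↔ v ∈ X

/-- A renaming substitution: a sort-preserving permutation of the variables. -/
abbrev Renaming (Sg : Signature.{u}) := Sg.Srt → Equiv.Perm ℕ

def Renaming.toVarMap (ϑ : Renaming Sg) : VarMap Sg := fun s n => ϑ s n

/-- A configuration of the strategy: the current definitions, those which have been unfolded, and
the clauses obtained by unfolding them. -/
structure Config (Sg : Signature.{u}) where
  defs : Set (Definition Sg)
  unfolded : Set (Definition Sg)
  clauses : Set (Clause Sg)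

/-- The strategy starts from the predicate `unsafe`, that is, from `unsafe :- unsafe`, whose
unfolding yields the clauses for `unsafe`. -/
def Config.init (Sg : Signature.{u}) : Config Sg :=
  ⟨{⟨unsafeName, [], ⟨unsafeName, []⟩⟩}, ∅, ∅⟩

/-- One step of the strategy on the program `P`. -/
inductive Step (A : ConstraintDomain Sg) (P : Set (Clause Sg)) : Config Sg → Config Sg → Prop
  /-- A definition that has not been unfolded yet is unfolded. -/
  | unfold (K : Config Sg) (D : Definition Sg) (S : Set (Clause Sg))
      (hD : D ∈ K.defs) (hU : D ∉ K.unfolded) (hS : Unfolding A P D S) :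
      Step A P K ⟨K.defs, insert D K.unfolded, K.clauses ∪ S⟩
  /-- `C` cannot be folded with respect to its `i`-th body atom `B`, and no definition has a variant
  of `B` as its body: the definition `newp(V) :- B`, with `V` the linking variables, is added. -/
  | introduce (K : Config Sg) (C : Clause Sg) (i : Fin C.body.length) (p : ℕ) (V : List (Var Sg))
      (hC : C ∈ K.clauses) (hB : ¬ Foldable K.defs C i) (hp : Fresh P K.defs p)
      (hV : IsTuple V (C.linkvars i))
      (hvar : ¬ ∃ D ∈ K.defs, ∃ ϑ : Renaming Sg,
        (C.body.get i).subst ϑ.toVarMap.toSubst = D.body) :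
      Step A P K ⟨insert ⟨p, V, C.body.get i⟩ K.defs, K.unfolded, K.clauses⟩
  /-- `C` cannot be folded with respect to its `i`-th body atom `B`, and `Bϑ` is the body of the
  definition `D`, say `newq(Q) :- Bϑ`: it is replaced by `newp(L) :- Bϑ` with `L = Vϑ ∪ Q`, where `V`
  are the linking variables. The clauses obtained by unfolding `D` are discarded. -/
  | merge (K : Config Sg) (C : Clause Sg) (i : Fin C.body.length) (p : ℕ) (L : List (Var Sg))
      (D : Definition Sg) (ϑ : Renaming Sg)
      (hC : C ∈ K.clauses) (hB : ¬ Foldable K.defs C i) (hp : Fresh P K.defs p)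
      (hD : D ∈ K.defs) (hϑ : (C.body.get i).subst ϑ.toVarMap.toSubst = D.body)
      (hL : IsTuple L (ϑ.toVarMap.toFun '' C.linkvars i ∪ {v | v ∈ D.vars})) :
      Step A P K ⟨insert ⟨p, L, D.body⟩ (K.defs \ {D}), K.unfolded \ {D},
        {R ∈ K.clauses | R.head.name ≠ D.name}⟩

/-- The configurations that some run of the strategy on `P` reaches. -/
def Reachable (A : ConstraintDomain Sg) (P : Set (Clause Sg)) (K : Config Sg) : Prop :=
  Relation.ReflTransGen (Step A P) (Config.init Sg) K

/-- The strategy stops in the configuration `K` and outputs `P'`: all definitions have been unfolded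
and no new definition is needed for folding; `P'` consists of the clauses obtained by unfolding, each
of them folded with respect to all its body atoms. -/
def Outputs (K : Config Sg) (P' : Set (Clause Sg)) : Prop :=
  (∀ D ∈ K.defs, D ∈ K.unfolded) ∧
  (∀ C ∈ K.clauses, ∀ i : Fin C.body.length, Foldable K.defs C i) ∧
  ∃ f : Clause Sg → Clause Sg, (∀ C ∈ K.clauses, FoldsTo K.defs C (f C)) ∧ P' = f '' K.clauses

end Rules

end CLP

/-! Termination: unfolding maps variables to variables and leaves every other equation in the
constraint, so each definition body is a variable-for-variable instance of `unsafe` or of a body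
atom of the program. Up to variants there are finitely many such instances, and no two definitions
have variant bodies. Head variables are distinct and occur in the body, so `Config.weight` is
bounded. By `weight_lt_or`, introducing or merging raises the weight, while unfolding keeps the
definitions and leaves one fewer to unfold.

Correctness: each direction exhibits a model and uses leastness. The ground atoms all of whose
matching definitions have heads true in the output form a model of the program
(`isModel_of_outputs`). The instances of definition heads with a true body form a model of the
output (`isModel_output`). The latter needs `exists_valuation_of_foldsWith`: variables dropped by
folding are private to one atom, so they can be revalued freely. -/

namespace CLP

/-! ### Substitutions, valuations and variants. -/

section Terms

variable {Sg : Signature.{u}} {A : ConstraintDomain Sg}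

/-- The valuation `v ↦ (θ v) γ`. -/
def Subst.eval (θ : Subst Sg) (γ : Valuation A) : Valuation A := fun s n => (θ s n).eval γ

theorem Term.eval_subst (θ : Subst Sg) (γ : Valuation A) {s : Sg.Srt} (t : Term Sg s) :
    (t.subst θ).eval γ = t.eval (θ.eval γ) := by
  induction t with
  | var n => rfl
  | app f args ih => simp only [Term.subst, Term.eval, ih]

theorem Term.eval_congr {α β : Valuation A} {s : Sg.Srt} (t : Term Sg s)
    (h : ∀ v ∈ t.vars, α v.1 v.2 = β v.1 v.2) : t.eval α = t.eval β := by
  induction t with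
  | var n => exact h _ rfl
  | app f args ih =>
    simp only [Term.eval]
    congr 1
    funext i
    exact ih i fun v hv => h v (Set.mem_iUnion.2 ⟨i, hv⟩)

theorem Term.subst_congr {θ θ' : Subst Sg} {s : Sg.Srt} (t : Term Sg s)
    (h : ∀ v ∈ t.vars, θ v.1 v.2 = θ' v.1 v.2) : t.subst θ = t.subst θ' := by
  induction t with
  | var n => exact h _ rfl
  | app f args ih =>
    simp only [Term.subst]
    congr 1
    funext i
    exact ih i fun v hv => h v (Set.mem_iUnion.2 ⟨i, hv⟩)

theorem Term.subst_subst (θ θ' : Subst Sg) {s : Sg.Srt} (t : Term Sg s) :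
    (t.subst θ).subst θ' = t.subst fun s n => (θ s n).subst θ' := by
  induction t with
  | var n => rfl
  | app f args ih => simp only [Term.subst, ih]

theorem Term.subst_var {s : Sg.Srt} (t : Term Sg s) :
    t.subst (fun _ n => Term.var n) = t := by
  induction t with
  | var n => rfl
  | app f args ih => simp only [Term.subst, ih]

theorem Term.mem_vars_subst (θ : Subst Sg) {s : Sg.Srt} (t : Term Sg s) (v : Var Sg) :
    v ∈ (t.subst θ).vars ↔ ∃ w ∈ t.vars, v ∈ (θ w.1 w.2).vars := by
  induction t with
  | var n => simp [Term.subst, Term.vars]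
  | app f args ih =>
    simp only [Term.subst, Term.vars, Set.mem_iUnion, ih]
    constructor
    · rintro ⟨i, w, hw, hv⟩
      exact ⟨w, ⟨i, hw⟩, hv⟩
    · rintro ⟨w, ⟨i, hw⟩, hv⟩
      exact ⟨i, w, hw, hv⟩

theorem Term.finite_vars {s : Sg.Srt} (t : Term Sg s) : t.vars.Finite := by
  induction t with
  | var n => exact Set.finite_singleton _
  | app f args ih => exact Set.finite_iUnion ih

theorem AtomicConstraint.holds_subst (θ : Subst Sg) (γ : Valuation A)
    (a : AtomicConstraint Sg) : (a.subst θ).Holds γ ↔ a.Holds (θ.eval γ) := by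
  cases a <;> simp only [AtomicConstraint.subst, AtomicConstraint.Holds, Term.eval_subst]

theorem AtomicConstraint.holds_congr {α β : Valuation A} (a : AtomicConstraint Sg)
    (h : ∀ v ∈ a.vars, α v.1 v.2 = β v.1 v.2) : a.Holds α ↔ a.Holds β := by
  cases a with
  | eq t t' =>
    simp only [AtomicConstraint.Holds]
    rw [t.eval_congr fun v hv => h v (Or.inl hv), t'.eval_congr fun v hv => h v (Or.inr hv)]
  | rel r args =>
    simp only [AtomicConstraint.Holds]
    rw [funext fun i => (args i).eval_congr fun v hv => h v (Set.mem_iUnion.2 ⟨i, hv⟩)]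

theorem Atom.eval_subst (θ : Subst Sg) (γ : Valuation A) (B : Atom Sg) :
    (B.subst θ).eval γ = B.eval (θ.eval γ) := by
  simp [Atom.eval, Atom.subst, Term.eval_subst]

theorem Atom.eval_congr {α β : Valuation A} (B : Atom Sg)
    (h : ∀ v ∈ B.vars, α v.1 v.2 = β v.1 v.2) : B.eval α = B.eval β := by
  simp only [Atom.eval, GroundAtom.mk.injEq, true_and]
  refine List.map_congr_left fun t ht => ?_
  rw [t.2.eval_congr fun v hv => h v ⟨t, ht, hv⟩]

theorem Atom.subst_congr {θ θ' : Subst Sg} (B : Atom Sg)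
    (h : ∀ v ∈ B.vars, θ v.1 v.2 = θ' v.1 v.2) : B.subst θ = B.subst θ' := by
  simp only [Atom.subst, Atom.mk.injEq, true_and]
  refine List.map_congr_left fun t ht => ?_
  rw [t.2.subst_congr fun v hv => h v ⟨t, ht, hv⟩]

theorem Atom.subst_subst (θ θ' : Subst Sg) (B : Atom Sg) :
    (B.subst θ).subst θ' = B.subst fun s n => (θ s n).subst θ' := by
  simp [Atom.subst, Term.subst_subst]

theorem Atom.subst_var (B : Atom Sg) : B.subst (fun _ n => Term.var n) = B := by
  simp [Atom.subst, Term.subst_var]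

theorem Atom.mem_vars_subst (θ : Subst Sg) (B : Atom Sg) (v : Var Sg) :
    v ∈ (B.subst θ).vars ↔ ∃ w ∈ B.vars, v ∈ (θ w.1 w.2).vars := by
  simp only [Atom.vars, Atom.subst, List.mem_map, Set.mem_ofPred_eq]
  constructor
  · rintro ⟨_, ⟨t, ht, rfl⟩, hv⟩
    obtain ⟨w, hw, hv⟩ := (Term.mem_vars_subst _ _ _).1 hv
    exact ⟨w, ⟨t, ht, hw⟩, hv⟩
  · rintro ⟨w, ⟨t, ht, hw⟩, hv⟩
    exact ⟨_, ⟨t, ht, rfl⟩, (Term.mem_vars_subst _ _ _).2 ⟨w, hw, hv⟩⟩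

theorem Atom.vars_subst_toSubst (r : VarMap Sg) (B : Atom Sg) :
    (B.subst r.toSubst).vars = r.toFun '' B.vars := by
  ext v
  rw [Atom.mem_vars_subst]
  simp only [VarMap.toSubst, Term.vars, Set.mem_singleton_iff, Set.mem_image, VarMap.toFun, eq_comm]

theorem Atom.finite_vars (B : Atom Sg) : B.vars.Finite := by
  have : B.vars = ⋃ t ∈ {t | t ∈ B.args}, t.2.vars := by
    ext v
    simp [Atom.vars]
  rw [this]
  exact B.args.finite_toSet.biUnion fun t _ => t.2.finite_vars

theorem Atom.subst_renaming_symm {ϑ : Renaming Sg} {B B' : Atom Sg}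
    (h : B.subst ϑ.toVarMap.toSubst = B') :
    B'.subst (Renaming.toVarMap fun s => (ϑ s).symm).toSubst = B := by
  rw [← h, Atom.subst_subst]
  simp only [VarMap.toSubst, Renaming.toVarMap, Term.subst, Equiv.symm_apply_apply]
  exact B.subst_var

/-- Instances of an atom under two maps of variables that identify the same variables are
variants. -/
theorem Atom.exists_renaming_of_kernel_eq (B : Atom Sg) {r r' : VarMap Sg}
    (h : ∀ v ∈ B.vars, ∀ w ∈ B.vars, r.toFun v = r.toFun w ↔ r'.toFun v = r'.toFun w) :
    ∃ ϑ : Renaming Sg, (B.subst r.toSubst).subst ϑ.toVarMap.toSubst = B.subst r'.toSubst := by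
  have key : ∀ s, ∃ g : Equiv.Perm ℕ, ∀ n, (s, n) ∈ B.vars → g (r s n) = r' s n := by
    intro s
    set F : Set ℕ := {n | (s, n) ∈ B.vars}
    have hF : F.Finite := B.finite_vars.preimage (Prod.mk_right_injective s).injOn
    have hc : ∀ x : r s '' F, ∃ n ∈ F, r s n = x := fun x => x.2
    choose c hcF hc using hc
    have hinj : Function.Injective fun x => r' s (c x) := by
      intro x y hxy
      have := (h (s, c x) (hcF x) (s, c y) (hcF y)).2 (Prod.ext rfl hxy)
      have := congrArg Prod.snd this
      simp only [VarMap.toFun, hc] at this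
      exact Subtype.ext this
    have hlt : Cardinal.mk (r s '' F) < Cardinal.mk ℕ := by
      rw [Cardinal.mk_nat]
      exact Cardinal.lt_aleph0_iff_set_finite.2 (hF.image _)
    -- An injection from a finite subset of `ℕ` into `ℕ` extends to a permutation of `ℕ`.
    obtain ⟨g, hg⟩ := Cardinal.extend_function_of_lt ⟨_, hinj⟩ hlt ⟨Equiv.refl ℕ⟩
    refine ⟨g, fun n hn => ?_⟩
    have hx := hg ⟨r s n, n, hn, rfl⟩
    rw [hx]
    have := (h (s, c ⟨r s n, n, hn, rfl⟩) (hcF _) (s, n) hn).1 (Prod.ext rfl (hc _))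
    exact congrArg Prod.snd this
  choose g hg using key
  refine ⟨g, ?_⟩
  rw [Atom.subst_subst]
  refine B.subst_congr fun v hv => ?_
  simp only [VarMap.toSubst, Term.subst, Renaming.toVarMap, hg v.1 v.2 hv]

theorem Clause.finite_linkvars (C : Clause Sg) (i : Fin C.body.length) : (C.linkvars i).Finite :=
  (Atom.finite_vars _).inter_of_left _

/-- Occurrences are told apart by position, so a repeated atom is part of the context of its other
copy. -/
theorem Clause.vars_get_subset_restVars (C : Clause Sg) {i j : Fin C.body.length} (h : i ≠ j) :
    (C.body.get j).vars ⊆ C.restVars i := by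
  intro v hv
  refine Or.inr ⟨_, ?_, hv⟩
  rw [List.mem_eraseIdx_iff_getElem]
  exact ⟨j, j.2, fun e => h (Fin.ext e.symm), rfl⟩

end Terms

/-! ### Unfolding: existence and semantics of resolvents. -/

section Resolution

variable {Sg : Signature.{u}} {A : ConstraintDomain Sg}

theorem mem_nonVarEquations {as bs : List (STerm Sg)} {e : AtomicConstraint Sg} :
    e ∈ nonVarEquations as bs ↔ ∃ (s : Sg.Srt) (t t' : Term Sg s),
      ((⟨s, t⟩ : STerm Sg), (⟨s, t'⟩ : STerm Sg)) ∈ as.zip bs ∧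
      ¬ (STerm.IsVar ⟨s, t⟩ ∧ STerm.IsVar ⟨s, t'⟩) ∧ e = .eq t t' := by
  simp only [nonVarEquations, List.mem_filterMap]
  constructor
  · rintro ⟨⟨⟨s, t⟩, ⟨s', t'⟩⟩, hm, he⟩
    dsimp only at he
    split_ifs at he with hs hv
    subst hs
    exact ⟨s, t, t', hm, hv, (Option.some.inj he).symm⟩
  · rintro ⟨s, t, t', hm, hv, rfl⟩
    exact ⟨_, hm, by simp [hv]⟩

/-- Equal sort lists force equal lengths, so `zip` truncates nothing and pairs only terms of one
sort. -/
theorem map_eval_eq_iff {α β : Valuation A} {as bs : List (STerm Sg)}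
    (h : as.map Sigma.fst = bs.map Sigma.fst) :
    as.map (fun t => (⟨t.1, t.2.eval α⟩ : (s : Sg.Srt) × A.carrier s)) =
        bs.map (fun t => ⟨t.1, t.2.eval β⟩) ↔
      ∀ (s : Sg.Srt) (t t' : Term Sg s),
        ((⟨s, t⟩ : STerm Sg), (⟨s, t'⟩ : STerm Sg)) ∈ as.zip bs → t.eval α = t'.eval β := by
  induction as generalizing bs with
  | nil =>
    cases bs with
    | nil => simp
    | cons b bs => simp at h
  | cons a as ih =>
    cases bs with
    | nil => simp at h
    | cons b bs =>
      obtain ⟨s, t⟩ := a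
      obtain ⟨s', t'⟩ := b
      simp only [List.map_cons, List.cons.injEq] at h
      obtain ⟨rfl, h⟩ := h
      simp only [List.map_cons, List.cons.injEq, ih h, List.zip_cons_cons, List.mem_cons]
      constructor
      · rintro ⟨h1, h2⟩ s₁ t₁ t₁' (he | hm)
        · simp only [Prod.mk.injEq, Sigma.mk.injEq] at he
          obtain ⟨⟨rfl, rfl⟩, -, h3⟩ := he
          obtain rfl := eq_of_heq h3
          simpa using h1
        · exact h2 _ _ _ hm
      · intro h1
        exact ⟨by rw [h1 s t t' (Or.inl rfl)], fun s₁ t₁ t₁' hm => h1 _ _ _ (Or.inr hm)⟩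

theorem Atom.SamePred.eval_eq_iff {B B' : Atom Sg} (h : B.SamePred B') {α β : Valuation A} :
    B.eval α = B'.eval β ↔ ∀ (s : Sg.Srt) (t t' : Term Sg s),
      ((⟨s, t⟩ : STerm Sg), (⟨s, t'⟩ : STerm Sg)) ∈ B.args.zip B'.args →
        t.eval α = t'.eval β := by
  rw [← map_eval_eq_iff h.2]
  simp [Atom.eval, h.1]

theorem mem_zip_subst_args {B B' : Atom Sg} {θ θ' : Subst Sg} {s : Sg.Srt} {u u' : Term Sg s} :
    ((⟨s, u⟩ : STerm Sg), (⟨s, u'⟩ : STerm Sg)) ∈ (B.subst θ).args.zip (B'.subst θ').args ↔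
      ∃ t t' : Term Sg s, ((⟨s, t⟩ : STerm Sg), (⟨s, t'⟩ : STerm Sg)) ∈ B.args.zip B'.args ∧
        u = t.subst θ ∧ u' = t'.subst θ' := by
  simp only [Atom.subst, List.zip_map, List.mem_map, Prod.exists, Prod.map_apply, Prod.mk.injEq]
  constructor
  · rintro ⟨⟨s₁, t⟩, ⟨s₂, t'⟩, hm, h1, h2⟩
    cases h1
    cases h2
    exact ⟨t, t', hm, rfl, rfl⟩
  · rintro ⟨t, t', hm, rfl, rfl⟩
    exact ⟨_, _, hm, rfl, rfl⟩

/-- A valuation of the variables of a definition and of a clause that equates the body of the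
former and the head of the latter factors through the unifier. -/
theorem Resolvent.exists_valuation {D : Definition Sg} {C R : Clause Sg} (h : Resolvent D C R)
    {α β : Valuation A} (he : D.body.eval α = C.head.eval β) (hc : ∀ a ∈ C.constr, a.Holds β) :
    ∃ γ : Valuation A, R.head.eval γ = D.head.eval α ∧ (∀ a ∈ R.constr, a.Holds γ) ∧
      R.body.map (Atom.eval γ) = C.body.map (Atom.eval β) := by
  obtain ⟨hp, ρ, ρ', hk, hh, hcon, hb⟩ := h
  rw [hp.eval_eq_iff] at he
  -- Bundling values with their sorts makes both valuations one function, constant on the classes of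
  -- the variable equations.
  let val : Var Sg ⊕ Var Sg → (s : Sg.Srt) × A.carrier s :=
    Sum.elim (fun v => ⟨v.1, α v.1 v.2⟩) fun v => ⟨v.1, β v.1 v.2⟩
  have hgen : ∀ a b, Relation.EqvGen (VarEquation D.body.args C.head.args) a b →
      val a = val b := by
    intro a b hab
    induction hab with
    | rel a b h =>
      obtain ⟨s, m, n, h⟩ := h
      have := he _ _ _ h
      simp only [Term.eval] at this
      simp [val, this]
    | refl => rfl
    | symm _ _ _ ih => exact ih.symm
    | trans _ _ _ _ _ ih ih' => exact ih.trans ih'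
  have hval : ∀ a b, Sum.elim ρ.toFun ρ'.toFun a = Sum.elim ρ.toFun ρ'.toFun b →
      val a = val b := fun a b hab => hgen a b ((hk a b).1 hab)
  -- The value at a variable is read off from any preimage under `ρ` or `ρ'`; outside both ranges it
  -- is arbitrary, as carriers are nonempty.
  have hex : ∀ s n, ∃ x : A.carrier s, (∀ m, ρ s m = n → α s m = x) ∧
      ∀ m, ρ' s m = n → β s m = x := by
    intro s n
    by_cases h1 : ∃ m, ρ s m = n
    · obtain ⟨m, rfl⟩ := h1
      refine ⟨α s m, fun m' hm => ?_, fun m' hm => ?_⟩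
      · exact eq_of_heq (Sigma.mk.inj (hval (.inl (s, m')) (.inl (s, m)) (Prod.ext rfl hm))).2
      · exact eq_of_heq (Sigma.mk.inj (hval (.inr (s, m')) (.inl (s, m)) (Prod.ext rfl hm))).2
    · by_cases h2 : ∃ m, ρ' s m = n
      · obtain ⟨m, rfl⟩ := h2
        refine ⟨β s m, fun m' hm => absurd ⟨m', hm⟩ h1, fun m' hm => ?_⟩
        exact eq_of_heq (Sigma.mk.inj (hval (.inr (s, m')) (.inr (s, m)) (Prod.ext rfl hm))).2
      · exact ⟨(A.nonempty s).some, fun m hm => absurd ⟨m, hm⟩ h1,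
          fun m hm => absurd ⟨m, hm⟩ h2⟩
  choose γ hγ hγ' using hex
  have e1 : ρ.toSubst.eval γ = α := by
    funext s n
    exact (hγ s _ n rfl).symm
  have e2 : ρ'.toSubst.eval γ = β := by
    funext s n
    exact (hγ' s _ n rfl).symm
  refine ⟨γ, ?_, ?_, ?_⟩
  · rw [hh, Atom.eval_subst, e1]
  · intro a ha
    rw [hcon, List.mem_append] at ha
    rcases ha with ha | ha
    · obtain ⟨s, u, u', hm, -, rfl⟩ := mem_nonVarEquations.1 ha
      obtain ⟨t, t', hm', rfl, rfl⟩ := mem_zip_subst_args.1 hm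
      simp only [AtomicConstraint.Holds, Term.eval_subst, e1, e2]
      exact he _ _ _ hm'
    · obtain ⟨a, ha', rfl⟩ := List.mem_map.1 ha
      rw [AtomicConstraint.holds_subst, e2]
      exact hc a ha'
  · rw [hb, List.map_map]
    refine List.map_congr_left fun B _ => ?_
    rw [Function.comp_apply, Atom.eval_subst, e2]

/-- A solution of the constraint of a resolvent solves the equations between the body of the
definition and the head of the clause. -/
theorem Resolvent.exists_unifier {D : Definition Sg} {C R : Clause Sg} (h : Resolvent D C R)
    {γ : Valuation A} (hc : ∀ a ∈ R.constr, a.Holds γ) :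
    ∃ α β : Valuation A, D.body.eval α = C.head.eval β ∧ (∀ a ∈ C.constr, a.Holds β) ∧
      R.head.eval γ = D.head.eval α ∧ R.body.map (Atom.eval γ) = C.body.map (Atom.eval β) := by
  obtain ⟨hp, ρ, ρ', hk, hh, hcon, hb⟩ := h
  refine ⟨ρ.toSubst.eval γ, ρ'.toSubst.eval γ, ?_, ?_, ?_, ?_⟩
  · rw [hp.eval_eq_iff]
    intro s t t' hm
    rw [← Term.eval_subst, ← Term.eval_subst]
    by_cases hv : STerm.IsVar (⟨s, t⟩ : STerm Sg) ∧ STerm.IsVar (⟨s, t'⟩ : STerm Sg)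
    · obtain ⟨⟨m, hm'⟩, ⟨n, hn⟩⟩ := hv
      obtain rfl : t = .var m := hm'
      obtain rfl : t' = .var n := hn
      have := (hk _ _).2 (Relation.EqvGen.rel _ _ (VarEquation.mk s m n hm))
      have : ρ s m = ρ' s n := congrArg Prod.snd this
      simp only [Term.subst, VarMap.toSubst, this]
    -- Variable maps send applications to applications, so a pair that is not variable-variable
    -- stays so and its equation is kept in `R.constr`.
    · have : AtomicConstraint.eq (t.subst ρ.toSubst) (t'.subst ρ'.toSubst) ∈ R.constr := by
        rw [hcon, List.mem_append]
        refine Or.inl (mem_nonVarEquations.2 ⟨s, _, _, mem_zip_subst_args.2 ⟨t, t', hm, rfl, rfl⟩,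
          fun h => hv ?_, rfl⟩)
        refine ⟨?_, ?_⟩
        · cases t with
          | var n => exact ⟨n, rfl⟩
          | app f args => obtain ⟨⟨n, hn⟩, -⟩ := h; cases hn
        · cases t' with
          | var n => exact ⟨n, rfl⟩
          | app f args => obtain ⟨-, ⟨n, hn⟩⟩ := h; cases hn
      exact hc _ this
  · intro a ha
    rw [← AtomicConstraint.holds_subst]
    exact hc _ (by rw [hcon]; exact List.mem_append_right _ (List.mem_map_of_mem ha))
  · rw [hh, Atom.eval_subst]
  · rw [hb, List.map_map]
    refine List.map_congr_left fun B _ => ?_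
    rw [Function.comp_apply, Atom.eval_subst]

/-- This lets `exists_resolvent` build the unifier one sort at a time. -/
theorem VarEquation.fst_eq {as bs : List (STerm Sg)} {a b : Var Sg ⊕ Var Sg}
    (h : Relation.EqvGen (VarEquation as bs) a b) :
    Sum.elim Prod.fst Prod.fst a = Sum.elim Prod.fst Prod.fst b := by
  induction h with
  | rel a b h => obtain ⟨s, m, n, h⟩ := h; rfl
  | refl => rfl
  | symm _ _ _ ih => exact ih.symm
  | trans _ _ _ _ _ ih ih' => exact ih.trans ih'

theorem exists_resolvent {D : Definition Sg} {C : Clause Sg} (h : D.body.SamePred C.head) :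
    ∃ R, Resolvent D C R := by
  let r := Relation.EqvGen.setoid (VarEquation D.body.args C.head.args)
  let emb : Sg.Srt → ℕ ⊕ ℕ → Var Sg ⊕ Var Sg := fun s => Sum.map (Prod.mk s) (Prod.mk s)
  have hc : ∀ s, ∃ g : ℕ ⊕ ℕ → ℕ, ∀ a b, g a = g b ↔ r (emb s a) (emb s b) := by
    intro s
    -- The classes within one sort are countable; numbering them injectively gives a most general
    -- unifier that also renames apart.
    obtain ⟨f, hf⟩ := exists_injective_nat (Quotient (r.comap (emb s)))
    refine ⟨fun a => f ⟦a⟧, fun a b => ?_⟩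
    rw [hf.eq_iff, Quotient.eq]
    rfl
  choose g hg using hc
  refine ⟨⟨_, _, _⟩, h, fun s n => g s (.inl n), fun s n => g s (.inr n), ?_, rfl, rfl, rfl⟩
  have hsplit : ∀ a : Var Sg ⊕ Var Sg, ∃ s x, a = emb s x := by
    rintro (⟨s, n⟩ | ⟨s, n⟩)
    · exact ⟨s, .inl n, rfl⟩
    · exact ⟨s, .inr n, rfl⟩
  have hval : ∀ s x, Sum.elim (VarMap.toFun fun s n => g s (.inl n))
      (VarMap.toFun fun s n => g s (.inr n)) (emb s x) = (s, g s x) := by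
    rintro s (n | n) <;> rfl
  have hfst : ∀ s x, Sum.elim Prod.fst Prod.fst (emb s x) = s := by
    rintro s (n | n) <;> rfl
  intro a b
  obtain ⟨s, x, rfl⟩ := hsplit a
  obtain ⟨s', y, rfl⟩ := hsplit b
  rw [hval, hval]
  constructor
  · intro he
    obtain ⟨rfl, he⟩ := Prod.mk.inj he
    exact (hg _ _ _).1 he
  · intro hr
    obtain rfl : s = s' := by simpa only [hfst] using VarEquation.fst_eq hr
    rw [(hg _ _ _).2 hr]

theorem Resolvent.head_name {D : Definition Sg} {C R : Clause Sg} (h : Resolvent D C R) :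
    R.head.name = D.name := by
  obtain ⟨-, ρ, ρ', -, hh, -⟩ := h
  rw [hh]
  rfl

/-- No clause with a matching head is omitted here. -/
theorem exists_unfolding (A : ConstraintDomain Sg) (P : Set (Clause Sg)) (D : Definition Sg) :
    ∃ S, Unfolding A P D S := by
  classical
  have h : ∀ C : Clause Sg, ∃ R, D.body.SamePred C.head → Resolvent D C R := by
    intro C
    by_cases h : D.body.SamePred C.head
    · obtain ⟨R, hR⟩ := exists_resolvent h
      exact ⟨R, fun _ => hR⟩
    · exact ⟨C, fun h' => absurd h' h⟩
  choose r hr using h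
  refine ⟨_, _, subset_rfl, ?_, r, fun C hC => hr C hC.2, rfl⟩
  rintro C hC ⟨α, β, he, -⟩
  refine ⟨hC, congrArg GroundAtom.name he, ?_⟩
  have := congrArg (fun g => g.args.map Sigma.fst) he
  simpa [Atom.eval, Function.comp_def] using this

end Resolution

/-! ### Folding: when it is possible, and how dropped variables can be revalued. -/

section Folding

variable {Sg : Signature.{u}} {A : ConstraintDomain Sg}

/-- The inverse renaming is the match: a body variable outside the head comes from a non-linking
variable, hence one occurring only in this atom, and injectivity gives distinctness. The
contrapositive makes merging enlarge the head. -/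
theorem foldsWith_of_linkvars_subset {C : Clause Sg} {i : Fin C.body.length} {D : Definition Sg}
    {ϑ : Renaming Sg} (hϑ : (C.body.get i).subst ϑ.toVarMap.toSubst = D.body)
    (h : ϑ.toVarMap.toFun '' C.linkvars i ⊆ {v | v ∈ D.vars}) :
    FoldsWith C i D (Renaming.toVarMap fun s => (ϑ s).symm).toSubst := by
  have hsymm := Atom.subst_renaming_symm hϑ
  refine ⟨hsymm, fun v hv hvD => ⟨(ϑ v.1).symm v.2, rfl, fun hr => hvD ?_, fun w _ hwv hm => ?_⟩⟩
  · refine h ⟨(v.1, (ϑ v.1).symm v.2), ⟨?_, hr⟩, ?_⟩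
    · rw [← hsymm, Atom.vars_subst_toSubst]
      exact ⟨v, hv, rfl⟩
    · exact Prod.ext rfl ((ϑ v.1).apply_symm_apply v.2)
  · obtain ⟨s, n⟩ := v
    obtain ⟨s', n'⟩ := w
    simp only [VarMap.toSubst, Renaming.toVarMap, Term.vars, Set.mem_singleton_iff,
      Prod.mk.injEq] at hm
    obtain ⟨rfl, hm⟩ := hm
    exact hwv (Prod.ext rfl ((ϑ s).symm.injective hm).symm)

/-- Values prescribed for the bodies of the definitions used for folding, provided they agree with
the folded atoms, can be realized by changing the valuation of the variables removed by folding. -/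
theorem exists_valuation_of_foldsWith {C : Clause Sg} {D : Fin C.body.length → Definition Sg}
    {θ : Fin C.body.length → Subst Sg} (hF : ∀ i, FoldsWith C i (D i) (θ i))
    {γ : Valuation A} {β : Fin C.body.length → Valuation A}
    (hβ : ∀ i, ∀ v ∈ (D i).vars, β i v.1 v.2 = (θ i v.1 v.2).eval γ) :
    ∃ γ' : Valuation A, C.head.eval γ' = C.head.eval γ ∧
      (∀ a ∈ C.constr, a.Holds γ → a.Holds γ') ∧
      ∀ i, (C.body.get i).eval γ' = (D i).body.eval (β i) := by
  -- `Loc i s n m`: folding atom `i` drops the variable `(s, n)` of `C`, the image of the non-head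
  -- variable `(s, m)` of `D i`.
  let Loc : Fin C.body.length → Sg.Srt → ℕ → ℕ → Prop := fun i s n m =>
    (s, m) ∈ (D i).body.vars ∧ (s, m) ∉ (D i).vars ∧ θ i s m = .var n
  have hrest : ∀ {i s n m}, Loc i s n m → (s, n) ∉ C.restVars i ∧
      ∀ w ∈ (D i).body.vars, w ≠ (s, m) → (s, n) ∉ (θ i w.1 w.2).vars := by
    rintro i s n m ⟨h1, h2, h3⟩
    obtain ⟨n', hn, h4, h5⟩ := (hF i).2 _ h1 h2
    obtain rfl : n = n' := Term.var.inj (h3.symm.trans hn)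
    exact ⟨h4, h5⟩
  have hbody : ∀ {i w v}, w ∈ (D i).body.vars → v ∈ (θ i w.1 w.2).vars →
      v ∈ (C.body.get i).vars := by
    intro i w v hw hv
    rw [← (hF i).1, Atom.mem_vars_subst]
    exact ⟨w, hw, hv⟩
  -- A dropped variable occurs in one body atom only and under one definition variable, so the
  -- prescribed values cannot conflict.
  have huniq : ∀ {i w v}, w ∈ (D i).body.vars → v ∈ (θ i w.1 w.2).vars →
      ∀ {j m}, Loc j v.1 v.2 m → j = i ∧ w = (v.1, m) := by
    intro i w v hw hv j m hL
    have hji : j = i := by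
      by_contra hji
      exact (hrest hL).1 (C.vars_get_subset_restVars hji (hbody hw hv))
    subst hji
    refine ⟨rfl, ?_⟩
    by_contra hwv
    exact (hrest hL).2 w hw hwv hv
  have hex : ∀ s n, ∃ x : A.carrier s, (∀ i m, Loc i s n m → x = β i s m) ∧
      ((¬ ∃ i m, Loc i s n m) → x = γ s n) := by
    intro s n
    by_cases h : ∃ i m, Loc i s n m
    · obtain ⟨i, m, hL⟩ := h
      refine ⟨β i s m, fun j m' hL' => ?_, fun h' => absurd ⟨i, m, hL⟩ h'⟩
      obtain ⟨rfl, hm⟩ := huniq (v := (s, n)) hL.1 (by simp [hL.2.2, Term.vars]) hL'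
      rw [(Prod.mk.inj hm).2]
    · exact ⟨γ s n, fun i m hL => absurd ⟨i, m, hL⟩ h, fun _ => rfl⟩
  choose γ' h1 h2 using hex
  have hout : ∀ v : Var Sg, (∀ i, v ∈ C.restVars i) → γ' v.1 v.2 = γ v.1 v.2 := fun v hv =>
    h2 _ _ fun ⟨i, m, hL⟩ => (hrest hL).1 (hv i)
  refine ⟨γ', Atom.eval_congr _ fun v hv => hout v fun i => Or.inl (Or.inl hv), ?_, fun i => ?_⟩
  · intro a ha
    exact (a.holds_congr fun v hv => hout v fun i => Or.inl (Or.inr ⟨a, ha, hv⟩)).2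
  · rw [← (hF i).1, Atom.eval_subst]
    refine Atom.eval_congr _ fun v hv => ?_
    -- The image of a head variable contains no dropped variable, so `γ'` agrees with `γ` there;
    -- elsewhere `γ'` was set to `β i`.
    by_cases hvD : v ∈ (D i).vars
    · rw [hβ i v hvD]
      refine Term.eval_congr _ fun w hw => h2 _ _ ?_
      rintro ⟨j, m, hL⟩
      obtain ⟨rfl, rfl⟩ := huniq hv hw hL
      exact hL.2.1 hvD
    · obtain ⟨n, hn, -⟩ := (hF i).2 v hv hvD
      simp only [Subst.eval, hn, Term.eval]
      exact h1 _ _ _ _ ⟨hv, hvD, hn⟩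

end Folding

/-! ### Invariants of the strategy. -/

section Invariant

variable {Sg : Signature.{u}}

/-- The definition `unsafe :- unsafe`. -/
def Definition.unsafeDef (Sg : Signature.{u}) : Definition Sg := ⟨unsafeName, [], ⟨unsafeName, []⟩⟩

/-- The atoms of which the bodies of all definitions are instances: `unsafe` and the body atoms of
the program. -/
def sourceAtoms (P : Set (Clause Sg)) : Set (Atom Sg) :=
  insert ⟨unsafeName, []⟩ (⋃ C ∈ P, {B | B ∈ C.body})

theorem finite_sourceAtoms {P : Set (Clause Sg)} (hP : P.Finite) : (sourceAtoms P).Finite :=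
  (hP.biUnion fun C _ => C.body.finite_toSet).insert _

theorem Unfolding.finite {A : ConstraintDomain Sg} {P S : Set (Clause Sg)} {D : Definition Sg}
    (hP : P.Finite) (h : Unfolding A P D S) : S.Finite := by
  obtain ⟨T, hT, -, r, -, rfl⟩ := h
  exact (hP.subset fun C hC => (hT hC).1).image r

theorem Unfolding.head_name {A : ConstraintDomain Sg} {P S : Set (Clause Sg)} {D : Definition Sg}
    (h : Unfolding A P D S) {R : Clause Sg} (hR : R ∈ S) : R.head.name = D.name := by
  obtain ⟨T, -, -, r, hr, rfl⟩ := h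
  obtain ⟨C, hC, rfl⟩ := hR
  exact (hr C hC).head_name

/-- Terms never grow: the unifier replaces variables by variables only. -/
theorem Unfolding.exists_instance {A : ConstraintDomain Sg} {P S : Set (Clause Sg)}
    {D : Definition Sg} (h : Unfolding A P D S) {R : Clause Sg} (hR : R ∈ S) {B : Atom Sg}
    (hB : B ∈ R.body) : ∃ B' ∈ sourceAtoms P, ∃ ρ : VarMap Sg, B = B'.subst ρ.toSubst := by
  obtain ⟨T, hT, -, r, hr, rfl⟩ := h
  obtain ⟨C, hC, rfl⟩ := hR
  obtain ⟨-, -, ρ', -, -, -, hb⟩ := hr C hC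
  rw [hb] at hB
  obtain ⟨B', hB', rfl⟩ := List.mem_map.1 hB
  exact ⟨B', Or.inr (Set.mem_biUnion (hT hC).1 hB'), ρ', rfl⟩

/-- The invariant of the strategy. -/
structure Config.Invariant (A : ConstraintDomain Sg) (P : Set (Clause Sg)) (K : Config Sg) :
    Prop where
  finite_defs : K.defs.Finite
  unsafeDef_mem : Definition.unsafeDef Sg ∈ K.defs
  eq_of_name_eq : ∀ D ∈ K.defs, ∀ D' ∈ K.defs, D.name = D'.name → D = D'
  eq_of_variant : ∀ D ∈ K.defs, ∀ D' ∈ K.defs, ∀ ϑ : Renaming Sg,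
    D.body.subst ϑ.toVarMap.toSubst = D'.body → D = D'
  exists_instance : ∀ D ∈ K.defs, ∃ B ∈ sourceAtoms P, ∃ ρ : VarMap Sg,
    D.body = B.subst ρ.toSubst
  nodup_vars : ∀ D ∈ K.defs, D.vars.Nodup
  vars_subset : ∀ D ∈ K.defs, ∀ v ∈ D.vars, v ∈ D.body.vars
  unfolded_subset : K.unfolded ⊆ K.defs
  exists_unfoldings : ∃ S : Definition Sg → Set (Clause Sg),
    (∀ D ∈ K.unfolded, Unfolding A P D (S D)) ∧ K.clauses = ⋃ D ∈ K.unfolded, S D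

theorem Config.invariant_init (A : ConstraintDomain Sg) (P : Set (Clause Sg)) :
    (Config.init Sg).Invariant A P where
  finite_defs := Set.finite_singleton _
  unsafeDef_mem := rfl
  eq_of_name_eq := by
    rintro _ rfl _ rfl _
    rfl
  eq_of_variant := by
    rintro _ rfl _ rfl _ _
    rfl
  exists_instance := by
    rintro _ rfl
    exact ⟨_, Or.inl rfl, fun _ n => n, rfl⟩
  nodup_vars := by
    rintro _ rfl
    exact List.nodup_nil
  vars_subset := by
    rintro _ rfl v hv
    cases hv
  unfolded_subset := Set.empty_subset _
  exists_unfoldings := ⟨fun _ => ∅, fun _ h => h.elim, by simp [Config.init]⟩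

namespace Config.Invariant

variable {A : ConstraintDomain Sg} {P : Set (Clause Sg)} {K : Config Sg}

theorem finite_clauses (hK : K.Invariant A P) (hP : P.Finite) : K.clauses.Finite := by
  obtain ⟨S, hS, hc⟩ := hK.exists_unfoldings
  rw [hc]
  exact (hK.finite_defs.subset hK.unfolded_subset).biUnion fun D hD => (hS D hD).finite hP

theorem exists_instance_of_mem_body (hK : K.Invariant A P) {C : Clause Sg} (hC : C ∈ K.clauses)
    {B : Atom Sg} (hB : B ∈ C.body) :
    ∃ B' ∈ sourceAtoms P, ∃ ρ : VarMap Sg, B = B'.subst ρ.toSubst := by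
  obtain ⟨S, hS, hc⟩ := hK.exists_unfoldings
  rw [hc] at hC
  obtain ⟨D, hD, hCD⟩ := Set.mem_iUnion₂.1 hC
  exact (hS D hD).exists_instance hCD hB

theorem unfold (hK : K.Invariant A P) {D : Definition Sg} {S : Set (Clause Sg)} (hD : D ∈ K.defs)
    (hU : D ∉ K.unfolded) (hS : Unfolding A P D S) :
    Invariant A P ⟨K.defs, insert D K.unfolded, K.clauses ∪ S⟩ where
  __ := hK
  unfolded_subset := Set.insert_subset hD hK.unfolded_subset
  exists_unfoldings := by
    classical
    obtain ⟨S', hS', hc⟩ := hK.exists_unfoldings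
    refine ⟨Function.update S' D S, ?_, ?_⟩
    · rintro D' (rfl | hD')
      · rwa [Function.update_self]
      · rw [Function.update_of_ne (ne_of_mem_of_not_mem hD' hU)]
        exact hS' D' hD'
    · simp only [Set.biUnion_insert, Function.update_self]
      rw [Set.union_comm, hc]
      congr 1
      refine Set.iUnion₂_congr fun D' hD' => ?_
      rw [Function.update_of_ne (ne_of_mem_of_not_mem hD' hU)]

/-- Adding a definition with a fresh name whose body is no variant of another body. -/
theorem insert_def (hK : K.Invariant A P) {D : Definition Sg}
    (hname : ∀ D' ∈ K.defs, D.name ≠ D'.name)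
    (hvar : ¬ ∃ D' ∈ K.defs, ∃ ϑ : Renaming Sg, D.body.subst ϑ.toVarMap.toSubst = D'.body)
    (hinst : ∃ B ∈ sourceAtoms P, ∃ ρ : VarMap Sg, D.body = B.subst ρ.toSubst)
    (hnd : D.vars.Nodup) (hsub : ∀ v ∈ D.vars, v ∈ D.body.vars) :
    Invariant A P ⟨insert D K.defs, K.unfolded, K.clauses⟩ where
  finite_defs := hK.finite_defs.insert _
  unsafeDef_mem := Or.inr hK.unsafeDef_mem
  eq_of_name_eq := by
    rintro D₁ (rfl | h₁) D₂ (rfl | h₂) h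
    · rfl
    · exact absurd h (hname _ h₂)
    · exact absurd h.symm (hname _ h₁)
    · exact hK.eq_of_name_eq _ h₁ _ h₂ h
  eq_of_variant := by
    rintro D₁ (rfl | h₁) D₂ (rfl | h₂) ϑ h
    · rfl
    · exact absurd ⟨_, h₂, _, h⟩ hvar
    · exact absurd ⟨_, h₁, _, Atom.subst_renaming_symm h⟩ hvar
    · exact hK.eq_of_variant _ h₁ _ h₂ ϑ h
  exists_instance := by
    rintro D₁ (rfl | h₁)
    · exact hinst
    · exact hK.exists_instance _ h₁
  nodup_vars := by
    rintro D₁ (rfl | h₁)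
    · exact hnd
    · exact hK.nodup_vars _ h₁
  vars_subset := by
    rintro D₁ (rfl | h₁)
    · exact hsub
    · exact hK.vars_subset _ h₁
  unfolded_subset := hK.unfolded_subset.trans (Set.subset_insert _ _)
  exists_unfoldings := hK.exists_unfoldings

/-- As names identify definitions, filtering by head name discards exactly the clauses unfolded from
`D`. -/
theorem remove_def (hK : K.Invariant A P) {D : Definition Sg} (hD : D ∈ K.defs)
    (hne : D ≠ Definition.unsafeDef Sg) :
    Invariant A P ⟨K.defs \ {D}, K.unfolded \ {D}, {R ∈ K.clauses | R.head.name ≠ D.name}⟩ where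
  finite_defs := hK.finite_defs.sdiff
  unsafeDef_mem := ⟨hK.unsafeDef_mem, hne.symm⟩
  eq_of_name_eq D₁ h₁ D₂ h₂ := hK.eq_of_name_eq D₁ h₁.1 D₂ h₂.1
  eq_of_variant D₁ h₁ D₂ h₂ := hK.eq_of_variant D₁ h₁.1 D₂ h₂.1
  exists_instance D₁ h₁ := hK.exists_instance D₁ h₁.1
  nodup_vars D₁ h₁ := hK.nodup_vars D₁ h₁.1
  vars_subset D₁ h₁ := hK.vars_subset D₁ h₁.1
  unfolded_subset := Set.sdiff_subset_sdiff_left hK.unfolded_subset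
  exists_unfoldings := by
    obtain ⟨S, hS, hc⟩ := hK.exists_unfoldings
    refine ⟨S, fun D' hD' => hS D' hD'.1, ?_⟩
    ext R
    simp only [hc, Set.mem_iUnion, Set.mem_sdiff, Set.mem_singleton_iff,
      exists_prop]
    constructor
    · rintro ⟨⟨D', hD', hR⟩, hn⟩
      refine ⟨D', ⟨hD', ?_⟩, hR⟩
      rintro rfl
      exact hn ((hS _ hD').head_name hR)
    · rintro ⟨D', ⟨hD', hne'⟩, hR⟩
      refine ⟨⟨D', hD', hR⟩, fun hn => hne' ?_⟩
      rw [(hS _ hD').head_name hR] at hn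
      exact hK.eq_of_name_eq _ (hK.unfolded_subset hD') _ hD hn

/-- The body `unsafe` has no variables, so any atom matching it folds; hence merging never replaces
the initial definition. -/
theorem ne_unsafeDef_of_not_foldable (hK : K.Invariant A P) {C : Clause Sg}
    {i : Fin C.body.length} (hB : ¬ Foldable K.defs C i) {D : Definition Sg} {ϑ : Renaming Sg}
    (hϑ : (C.body.get i).subst ϑ.toVarMap.toSubst = D.body) : D ≠ Definition.unsafeDef Sg := by
  rintro rfl
  have h := Atom.subst_renaming_symm hϑ
  refine hB ⟨_, hK.unsafeDef_mem, _, h, fun v hv => ?_⟩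
  obtain ⟨t, ht, -⟩ := hv
  cases ht

theorem step (hK : K.Invariant A P) {K' : Config Sg} (h : Step A P K K') : K'.Invariant A P := by
  cases h with
  | unfold D S hD hU hS => exact hK.unfold hD hU hS
  | introduce C i p V hC hB hp hV hvar =>
    exact hK.insert_def (fun D' hD' => (hp.2 D' hD').1) hvar
      (hK.exists_instance_of_mem_body hC (List.get_mem _ _)) hV.1
      fun v hv => ((hV.2 v).1 hv).1
  | merge C i p L D ϑ hC hB hp hD hϑ hL =>
    -- A merge is a removal followed by the insertion of a definition with the same body.
    refine (hK.remove_def hD (hK.ne_unsafeDef_of_not_foldable hB hϑ)).insert_def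
      (D := ⟨p, L, D.body⟩) (fun D' hD' => (hp.2 D' hD'.1).1) ?_ (hK.exists_instance D hD) hL.1 ?_
    · rintro ⟨D', hD', ϑ', h'⟩
      exact hD'.2 (hK.eq_of_variant _ hD _ hD'.1 ϑ' h').symm
    · intro v hv
      rcases (hL.2 v).1 hv with hv | hv
      · change v ∈ D.body.vars
        rw [← hϑ, Atom.vars_subst_toSubst]
        exact Set.image_mono Set.inter_subset_left hv
      · exact hK.vars_subset D hD v hv

theorem of_reachable (h : Reachable A P K) : K.Invariant A P := by
  induction h with
  | refl => exact invariant_init A P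
  | tail _ h ih => exact ih.step h

end Config.Invariant

end Invariant

/-! ### Termination: bounded weight and progress. -/

section Termination

variable {Sg : Signature.{u}} {A : ConstraintDomain Sg} {P : Set (Clause Sg)} {K : Config Sg}

/-- The number of definitions together with the number of their head variables. -/
noncomputable def Config.weight (K : Config Sg) : ℕ := ∑ᶠ D ∈ K.defs, (D.vars.length + 1)

/-- An instance of a source atom is determined up to variants by the atom and the pairs of its
variables that are identified. -/
def instanceCodes (P : Set (Clause Sg)) : Set (Atom Sg × Set (Var Sg × Var Sg)) :=
  ⋃ B ∈ sourceAtoms P, Prod.mk B '' 𝒫 (B.vars ×ˢ B.vars)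

theorem finite_instanceCodes (hP : P.Finite) : (instanceCodes P).Finite :=
  (finite_sourceAtoms hP).biUnion fun B _ =>
    ((B.finite_vars.prod B.finite_vars).finite_subsets).image _

/-- Definitions with equal codes have variant bodies and so coincide by the invariant; the code is
injective into a finite set. -/
theorem Config.Invariant.ncard_defs_le (hK : K.Invariant A P) (hP : P.Finite) :
    K.defs.ncard ≤ (instanceCodes P).ncard := by
  have h : ∀ D : Definition Sg, ∃ (B : Atom Sg) (ρ : VarMap Sg), D ∈ K.defs →
      B ∈ sourceAtoms P ∧ D.body = B.subst ρ.toSubst := by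
    intro D
    by_cases hD : D ∈ K.defs
    · obtain ⟨B, hB, ρ, h⟩ := hK.exists_instance D hD
      exact ⟨B, ρ, fun _ => ⟨hB, h⟩⟩
    · exact ⟨D.body, fun _ n => n, fun h => absurd h hD⟩
  choose B ρ h using h
  let code : Definition Sg → Atom Sg × Set (Var Sg × Var Sg) := fun D =>
    (B D, {x ∈ (B D).vars ×ˢ (B D).vars | (ρ D).toFun x.1 = (ρ D).toFun x.2})
  refine Set.ncard_le_ncard_of_injOn code ?_ ?_ (finite_instanceCodes hP)
  · intro D hD
    exact Set.mem_biUnion (h D hD).1 ⟨_, Set.sep_subset _ _, rfl⟩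
  · intro D hD D' hD' he
    obtain ⟨h1, h2⟩ := Prod.mk.inj he
    rw [← h1] at h2
    obtain ⟨ϑ, hϑ⟩ := (B D).exists_renaming_of_kernel_eq (r := ρ D) (r' := ρ D') (by
      intro v hv w hw
      have := Set.ext_iff.1 h2 (v, w)
      exact ⟨fun h => (this.1 ⟨⟨hv, hw⟩, h⟩).2, fun h => (this.2 ⟨⟨hv, hw⟩, h⟩).2⟩)
    refine hK.eq_of_variant D hD D' hD' ϑ ?_
    rw [(h D hD).2, (h D' hD').2, hϑ, h1]

theorem Config.Invariant.length_vars_le (hK : K.Invariant A P) {m : ℕ}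
    (hm : ∀ B ∈ sourceAtoms P, B.vars.ncard ≤ m) {D : Definition Sg} (hD : D ∈ K.defs) :
    D.vars.length ≤ m := by
  classical
  obtain ⟨B, hB, ρ, hρ⟩ := hK.exists_instance D hD
  rw [← List.toFinset_card_of_nodup (hK.nodup_vars D hD), ← Set.ncard_coe_finset]
  refine (Set.ncard_le_ncard ?_ D.body.finite_vars).trans ?_
  · intro v hv
    exact hK.vars_subset D hD v (List.mem_toFinset.1 hv)
  · rw [hρ, Atom.vars_subst_toSubst]
    exact (Set.ncard_image_le B.finite_vars).trans (hm B hB)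

theorem exists_weight_le (A : ConstraintDomain Sg) (hP : P.Finite) :
    ∃ N, ∀ K : Config Sg, K.Invariant A P → K.weight ≤ N := by
  obtain ⟨m, hm⟩ := ((finite_sourceAtoms hP).image fun B => B.vars.ncard).bddAbove
  refine ⟨(instanceCodes P).ncard * (m + 1), fun K hK => ?_⟩
  rw [Config.weight, finsum_mem_eq_finite_toFinset_sum _ hK.finite_defs]
  refine (Finset.sum_le_card_nsmul _ _ (m + 1) fun D hD => ?_).trans ?_
  · exact Nat.succ_le_succ (hK.length_vars_le (fun B hB => hm ⟨B, hB, rfl⟩)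
      (hK.finite_defs.mem_toFinset.1 hD))
  · rw [smul_eq_mul, ← Set.ncard_eq_toFinset_card _ hK.finite_defs]
    exact Nat.mul_le_mul_right _ (hK.ncard_defs_le hP)

theorem Config.Invariant.weight_lt_or (hK : K.Invariant A P) {K' : Config Sg}
    (h : Step A P K K') : K.weight < K'.weight ∨
      K'.defs = K.defs ∧ (K'.defs \ K'.unfolded).ncard < (K.defs \ K.unfolded).ncard := by
  cases h with
  | unfold D S hD hU hS =>
    refine Or.inr ⟨rfl, Set.ncard_lt_ncard ?_ hK.finite_defs.sdiff⟩
    refine ⟨fun D' hD' => ⟨hD'.1, fun h => hD'.2 (Or.inr h)⟩, fun h => ?_⟩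
    exact (h ⟨hD, hU⟩).2 (Or.inl rfl)
  | introduce C i p V hC hB hp hV hvar =>
    left
    simp only [Config.weight]
    rw [finsum_mem_insert _ (fun h => (hp.2 _ h).1 rfl) hK.finite_defs]
    simp only
    omega
  | merge C i p L D ϑ hC hB hp hD hϑ hL =>
    left
    have hlt : D.vars.length < L.length := by
      -- If all renamed linking variables were already in the head, `D` itself could fold the atom.
      have hx : ¬ ϑ.toVarMap.toFun '' C.linkvars i ⊆ {v | v ∈ D.vars} := fun h =>
        hB ⟨D, hD, _, foldsWith_of_linkvars_subset hϑ h⟩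
      obtain ⟨x, hx, hxD⟩ := Set.not_subset.1 hx
      have : (x :: D.vars).Nodup := List.nodup_cons.2 ⟨hxD, hK.nodup_vars D hD⟩
      refine (this.subperm (l₂ := L) fun v hv => (hL.2 v).2 ?_).length_le
      rcases List.mem_cons.1 hv with rfl | hv
      · exact Or.inl hx
      · exact Or.inr hv
    have hfin : (K.defs \ {D}).Finite := hK.finite_defs.sdiff
    have h1 : K.weight = (D.vars.length + 1) + ∑ᶠ D' ∈ K.defs \ {D}, (D'.vars.length + 1) := by
      rw [← finsum_mem_insert (fun D : Definition Sg => D.vars.length + 1) (fun h => h.2 rfl) hfin,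
        Set.insert_sdiff_self_of_mem hD]
      rfl
    rw [h1]
    simp only [Config.weight]
    rw [finsum_mem_insert _ (fun h => (hp.2 _ h.1).1 rfl) hfin]
    simp only
    omega

theorem not_exists_infinite_run (A : ConstraintDomain Sg) (hP : P.Finite) :
    ¬ ∃ K : ℕ → Config Sg, K 0 = Config.init Sg ∧ ∀ n, Step A P (K n) (K (n + 1)) := by
  rintro ⟨K, h0, hK⟩
  have hinv : ∀ n, (K n).Invariant A P := by
    intro n
    induction n with
    | zero => rw [h0]; exact Config.invariant_init A P
    | succ n ih => exact ih.step (hK n)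
  obtain ⟨N, hN⟩ := exists_weight_le A hP
  let f : ℕ → ℕ ×ₗ ℕ := fun n =>
    toLex (N - (K n).weight, ((K n).defs \ (K n).unfolded).ncard)
  have hf : StrictAnti f := by
    refine strictAnti_nat_of_succ_lt fun n => ?_
    rw [Prod.Lex.toLex_lt_toLex]
    -- The bound on the next weight makes the truncated difference `N - weight` drop strictly.
    have h1 := hN _ (hinv (n + 1))
    rcases (hinv n).weight_lt_or (hK n) with h | ⟨h, h'⟩
    · left
      dsimp only
      omega
    · refine Or.inr ⟨?_, h'⟩
      simp only [Config.weight, h]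
  exact not_strictAnti_of_wellFoundedLT f hf

theorem exists_isTuple {X : Set (Var Sg)} (hX : X.Finite) : ∃ V, IsTuple V X :=
  ⟨hX.toFinset.toList, hX.toFinset.nodup_toList, fun v => by simp⟩

theorem exists_fresh (hP : P.Finite) {Defs : Set (Definition Sg)} (hD : Defs.Finite) :
    ∃ p, Fresh P Defs p := by
  have hfin : ((⋃ C ∈ P, insert C.head.name (Atom.name '' {B | B ∈ C.body})) ∪
      ⋃ D ∈ Defs, {D.name, D.body.name}).Finite :=
    (hP.biUnion fun C _ => (C.body.finite_toSet.image _).insert _).union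
      (hD.biUnion fun D _ => Set.toFinite _)
  obtain ⟨p, hp⟩ := hfin.exists_notMem
  refine ⟨p, fun C hC => ⟨?_, ?_⟩, fun D hD => ⟨?_, ?_⟩⟩
  · rintro rfl
    exact hp (Or.inl (Set.mem_biUnion hC (Or.inl rfl)))
  · rintro B hB rfl
    exact hp (Or.inl (Set.mem_biUnion hC (Or.inr ⟨B, hB, rfl⟩)))
  · rintro rfl
    exact hp (Or.inr (Set.mem_biUnion hD (Or.inl rfl)))
  · rintro rfl
    exact hp (Or.inr (Set.mem_biUnion hD (Or.inr rfl)))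

/-- Every obstacle to stopping enables a step: an unfolding for a pending definition; for an
unfoldable atom, a merge or an introduction according to whether some body is a variant of it. -/
theorem Config.Invariant.exists_outputs (hK : K.Invariant A P) (hP : P.Finite)
    (hterm : ¬ ∃ K', Step A P K K') : ∃ P', Outputs K P' := by
  have hunf : ∀ D ∈ K.defs, D ∈ K.unfolded := by
    intro D hD
    by_contra hU
    obtain ⟨S, hS⟩ := exists_unfolding A P D
    exact hterm ⟨_, Step.unfold K D S hD hU hS⟩
  have hfold : ∀ C ∈ K.clauses, ∀ i : Fin C.body.length, Foldable K.defs C i := by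
    intro C hC i
    by_contra hB
    obtain ⟨p, hp⟩ := exists_fresh hP hK.finite_defs
    by_cases hvar : ∃ D ∈ K.defs, ∃ ϑ : Renaming Sg,
        (C.body.get i).subst ϑ.toVarMap.toSubst = D.body
    · obtain ⟨D, hD, ϑ, hϑ⟩ := hvar
      obtain ⟨L, hL⟩ := exists_isTuple (((C.finite_linkvars i).image ϑ.toVarMap.toFun).union
        D.vars.finite_toSet)
      exact hterm ⟨_, Step.merge K C i p L D ϑ hC hB hp hD hϑ hL⟩
    · obtain ⟨V, hV⟩ := exists_isTuple (C.finite_linkvars i)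
      exact hterm ⟨_, Step.introduce K C i p V hC hB hp hV hvar⟩
  have hex : ∀ C : Clause Sg, ∃ C', C ∈ K.clauses → FoldsTo K.defs C C' := by
    intro C
    by_cases hC : C ∈ K.clauses
    · choose D hD θ hθ using hfold C hC
      refine ⟨⟨C.head, C.constr, List.ofFn fun i => (D i).head.subst (θ i)⟩, fun _ => ⟨rfl, rfl,
        List.length_ofFn, fun i => ⟨D i, hD i, θ i, hθ i, ?_⟩⟩⟩
      simp
    · exact ⟨C, fun h => absurd h hC⟩
  choose f hf using hex
  exact ⟨_, hunf, hfold, f, hf, rfl⟩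

end Termination

/-! ### Correctness: comparison of the least models. -/

section Correctness

variable {Sg : Signature.{u}} {A : ConstraintDomain Sg} {P P' : Set (Clause Sg)} {K : Config Sg}

theorem isModel_leastModel (A : ConstraintDomain Sg) (P : Set (Clause Sg)) :
    IsModel P (leastModel A P) :=
  (isLeast_leastModel P).1

theorem leastModel_subset {I : Set (GroundAtom A)} (h : IsModel P I) : leastModel A P ⊆ I :=
  (isLeast_leastModel P).2 h

theorem Definition.head_eval_eq_iff {D : Definition Sg} {α β : Valuation A} :
    D.head.eval α = D.head.eval β ↔ ∀ v ∈ D.vars, α v.1 v.2 = β v.1 v.2 := by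
  simp [Definition.head, Atom.eval, Term.eval]

/-- A true instance of `C` matching `D.body` witnesses that the resolvent was not omitted. Its body
atoms are instances of the bodies of the folding definitions, whose heads are true by hypothesis. -/
theorem Config.Invariant.isModel_of_outputs (hK : K.Invariant A P) (hO : Outputs K P') :
    IsModel P {a : GroundAtom A | ∀ D ∈ K.defs, ∀ α : Valuation A, D.body.eval α = a →
      D.head.eval α ∈ leastModel A P'} := by
  obtain ⟨hunf, -, f, hf, rfl⟩ := hO
  obtain ⟨S, hS, hcl⟩ := hK.exists_unfoldings
  intro C hC β hc hb D hD α he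
  obtain ⟨T, -, hT, r, hr, hSr⟩ := hS D (hunf D hD)
  have hCT := hT C hC ⟨α, β, he, hc⟩
  obtain ⟨γ, hγh, hγc, hγb⟩ := (hr C hCT).exists_valuation he hc
  have hR : r C ∈ K.clauses := by
    rw [hcl]
    refine Set.mem_biUnion (hunf D hD) ?_
    rw [hSr]
    exact ⟨C, hCT, rfl⟩
  obtain ⟨h1, h2, h3, h4⟩ := hf _ hR
  rw [← hγh, ← h1]
  refine isModel_leastModel A _ _ (Set.mem_image_of_mem f hR) γ (h2 ▸ hγc) fun B hB => ?_
  obtain ⟨n, rfl⟩ := List.get_of_mem hB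
  obtain ⟨D', hD', θ, hθ, hfold⟩ := h4 (n.cast h3)
  have hB' : ((r C).body.get (n.cast h3)).eval γ ∈ C.body.map (Atom.eval β) := by
    rw [← hγb]
    exact List.mem_map_of_mem (List.get_mem _ _)
  obtain ⟨B', hB', hBe⟩ := List.mem_map.1 hB'
  have := hb B' hB' D' hD' (θ.eval γ) (by rw [hBe, ← hθ.1, Atom.eval_subst])
  rwa [← Atom.eval_subst, ← hfold] at this

/-- A true folded atom only gives some valuation agreeing on the head variables of its definition,
so the dropped variables are revalued before the program clause is applied. -/
theorem Config.Invariant.isModel_output (hK : K.Invariant A P) (hO : Outputs K P') :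
    IsModel P' {a : GroundAtom A | ∃ D ∈ K.defs, ∃ α : Valuation A, D.head.eval α = a ∧
      D.body.eval α ∈ leastModel A P} := by
  obtain ⟨-, -, f, hf, rfl⟩ := hO
  obtain ⟨S, hS, hcl⟩ := hK.exists_unfoldings
  rintro _ ⟨R, hR, rfl⟩ γ hc hb
  obtain ⟨h1, h2, h3, h4⟩ := hf R hR
  choose D hD θ hF hfold using h4
  have hβ : ∀ i, ∃ β : Valuation A, (∀ v ∈ (D i).vars, β v.1 v.2 = (θ i v.1 v.2).eval γ) ∧
      (D i).body.eval β ∈ leastModel A P := by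
    intro i
    obtain ⟨D', hD', β, he, hβ⟩ := hb _ (List.get_mem _ (i.cast h3.symm))
    rw [hfold, Atom.eval_subst] at he
    obtain rfl := hK.eq_of_name_eq D' hD' (D i) (hD i) (congrArg GroundAtom.name he)
    exact ⟨β, Definition.head_eval_eq_iff.1 he, hβ⟩
  choose β hβ hβP using hβ
  obtain ⟨γ', hγh, hγc, hγb⟩ := exists_valuation_of_foldsWith hF hβ
  have hR' := hR
  rw [hcl] at hR'
  obtain ⟨D₀, hD₀, hRD⟩ := Set.mem_iUnion₂.1 hR'
  obtain ⟨T, hT, -, r, hr, hSr⟩ := hS D₀ hD₀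
  rw [hSr] at hRD
  obtain ⟨C, hC, rfl⟩ := hRD
  -- The unifier is taken at `γ'`, where the constraint still holds and the head is unchanged.
  obtain ⟨α, β', he, hc', hh, hbody⟩ := (hr C hC).exists_unifier (γ := γ')
    fun a ha => hγc a ha (hc a (h2 ▸ ha))
  refine ⟨D₀, hK.unfolded_subset hD₀, α, by rw [← hh, hγh, h1], ?_⟩
  rw [he]
  refine isModel_leastModel A P C (hT hC).1 β' hc' fun B hB => ?_
  have : B.eval β' ∈ (r C).body.map (Atom.eval γ') := by
    rw [hbody]
    exact List.mem_map_of_mem hB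
  obtain ⟨B', hB', hBe⟩ := List.mem_map.1 this
  obtain ⟨i, rfl⟩ := List.get_of_mem hB'
  rw [← hBe, hγb]
  exact hβP i

theorem Config.Invariant.unsafeIn_iff (hK : K.Invariant A P) (hO : Outputs K P') :
    UnsafeIn A P ↔ UnsafeIn A P' := by
  let α : Valuation A := fun s _ => (A.nonempty s).some
  constructor
  · intro h
    exact leastModel_subset (hK.isModel_of_outputs hO) h _ hK.unsafeDef_mem α rfl
  · intro h
    obtain ⟨D, hD, β, he, hb⟩ := leastModel_subset (hK.isModel_output hO) h
    obtain rfl := hK.eq_of_name_eq D hD _ hK.unsafeDef_mem (congrArg GroundAtom.name he)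
    exact hb

end Correctness

end CLP

theorem mainTheorem1 {Sg : CLP.Signature.{u}} (A : CLP.ConstraintDomain Sg)
    (P : Set (CLP.Clause Sg)) (hP : P.Finite) :
    -- termination: no run is infinite,
    (¬ ∃ K : ℕ → CLP.Config Sg, K 0 = CLP.Config.init Sg ∧
      ∀ n, CLP.Step A P (K n) (K (n + 1))) ∧
    -- and a run that cannot be continued has stopped with an output
    (∀ K, CLP.Reachable A P K → (¬ ∃ K', CLP.Step A P K K') → ∃ P', CLP.Outputs K P') ∧
    -- correctness: every output of every run is a program equivalent with respect to `unsafe`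
    (∀ K P', CLP.Reachable A P K → CLP.Outputs K P' →
      P'.Finite ∧ (CLP.UnsafeIn A P ↔ CLP.UnsafeIn A P')) := by
  refine ⟨CLP.not_exists_infinite_run A hP, fun K hK hterm => ?_, fun K P' hK hO => ?_⟩
  · exact (CLP.Config.Invariant.of_reachable hK).exists_outputs hP hterm
  · have hinv := CLP.Config.Invariant.of_reachable hK
    refine ⟨?_, hinv.unsafeIn_iff hO⟩
    obtain ⟨-, -, f, -, rfl⟩ := hO
    exact (hinv.finite_clauses hP).image f
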